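/- Let $q$ be a prime power, and let $\mu_{q^2+q+1}=\{u\in\mathbb{F}_{q^3} : u^{q^2+q+1}=1\}$. Let $A,B,C\in\mathbb{F}_q$ satisfy $C\neq 0$, $A+B+1\neq 0$, $A^3+AB+1\neq 0$, $A^2-AB-A+B^2-B+1\neq 0$ and $$A^3-ABC+AB+C^2-C+1=0,$$ and suppose that the polynomial $$m_{A,B,C}(t)=(AB-C)t^3+(-A^2C+AB^2-BC-B)t^2+(A^2B-AC^2-AC-B^2)t-AB+C\in\mathbb{F}_q[t]$$ has no roots in $\mu_{q^2+q+1}$. Then $$f(x)=x^{q^2+q-1}+Ax^{q^2-q+1}+Bx^{q^2}+Cx$$ is a permutation polynomial over $\mathbb{F}_{q^3}$, that is, the map $c\mapsto f(c)$ is a bijection of $\mathbb{F}_{q^3}$ onto itself. -/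

import Mathlib

open Polynomial

noncomputable section

/-- `f` is a permutation polynomial over the field `L`: the associated polynomial function
`c ↦ f(c)` is a permutation of `L`. -/
def IsPermutationPolynomial {L : Type*} [Field L] (f : L[X]) : Prop :=
  Function.Bijective (fun c : L => f.eval c)

/-- The set of `d`-th roots of unity in the field `L`. -/
def mu (L : Type*) [Field L] (d : ℕ) : Set L :=
  {x : L | x ^ d = 1}

/-- The cubic `m_{A,B,C}(t)`. -/
def mCubic {F : Type*} [Field F] (A B C : F) : F[X] :=
  Polynomial.C (A * B - C) * X ^ 3
    + Polynomial.C (-(A ^ 2 * C) + A * B ^ 2 - B * C - B) * X ^ 2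
    + Polynomial.C (A ^ 2 * B - A * C ^ 2 - A * C - B ^ 2) * X
    + Polynomial.C (-(A * B) + C)

/-- The polynomial `x^(q^2+q-1) + A x^(q^2-q+1) + B x^(q^2) + C x`. The truncated subtractions
are genuine, as it is used only for `q ≥ 2`. -/
def fQuad {F : Type*} [Field F] (q : ℕ) (A B C : F) : F[X] :=
  X ^ (q ^ 2 + q - 1) + Polynomial.C A * X ^ (q ^ 2 - q + 1)
    + Polynomial.C B * X ^ (q ^ 2) + Polynomial.C C * X

end

/-! Let `σ` be the `q`-Frobenius of `L` and `Q(X) = X² + A(σX)² + B XσX + C σXσ²X`. For `x ≠ 0`,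
`f(x)` is the norm of `x` times `Q(1/x)`. The conic behind `Q` and its cyclic shifts share three
base points over `F`, obtained from a root of the cubic (`exists_root_mCubic`, `basePoint_of_root`).
In coordinates based at these points `Q` becomes an invertible circulant applied to the Cremona map
`u ↦ σu σ²u`, which is injective up to scalars (`quadraticMap_injective`). So `f(x) = f(y)` forces
`x = cy` with `σc = c`, and `f(cy) = c f(y)` gives `c = 1`. -/

/-! ### Nonvanishing of the two circulants -/

/-- A vanishing circulant determinant has a vanishing eigenvalue. -/
theorem exists_cubeRoot_of_circulant_eq_zero {K : Type*} [Field K] [IsAlgClosed K] {a b c : K}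
    (h : a ^ 3 + b ^ 3 + c ^ 3 - 3 * a * b * c = 0) :
    ∃ θ : K, θ ^ 3 = 1 ∧ a + θ * b + θ ^ 2 * c = 0 := by
  obtain ⟨w, hw⟩ := IsAlgClosed.exists_root (X ^ 2 + X + 1 : K[X]) (by
    have : (X ^ 2 + X + 1 : K[X]).degree = 2 := by compute_degree!
    rw [this]; decide)
  have hw : w ^ 2 + w + 1 = 0 := by simpa [IsRoot] using hw
  have h3 : w ^ 3 = 1 := by linear_combination (w - 1) * hw
  have hprod : (a + b + c) * ((a + w * b + w ^ 2 * c) * (a + w ^ 2 * b + (w ^ 2) ^ 2 * c)) = 0 := by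
    grind
  rcases mul_eq_zero.1 hprod with h | h
  · exact ⟨1, by simp, by linear_combination h⟩
  rcases mul_eq_zero.1 h with h | h
  · exact ⟨w, h3, h⟩
  · exact ⟨w ^ 2, by linear_combination (w ^ 3 + 1) * h3, h⟩

/-- If the conic `x² + A y² + B xy + C yz` and its two cyclic shifts pass through the point
`(s, t, r)`, then the three shifts of this point are linearly independent unless `s³ = t³`. -/
theorem circulant_ne_zero_of_basePoint {F : Type*} [Field F] {A B C s t r : F}
    (e0 : s ^ 2 + A * t ^ 2 + B * s * t + C * t * r = 0)
    (e1 : t ^ 2 + A * r ^ 2 + B * t * r + C * r * s = 0)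
    (e2 : r ^ 2 + A * s ^ 2 + B * r * s + C * s * t = 0)
    (hst : s ^ 3 ≠ t ^ 3) :
    s ^ 3 + t ^ 3 + r ^ 3 - 3 * s * t * r ≠ 0 := by
  intro hD
  obtain ⟨i, hi⟩ : ∃ i : F →+* AlgebraicClosure F, Function.Injective i :=
    ⟨_, (algebraMap F (AlgebraicClosure F)).injective⟩
  obtain ⟨θ, hθ, hl⟩ := exists_cubeRoot_of_circulant_eq_zero
    (a := i s) (b := i t) (c := i r) (by simpa [map_ofNat i 3] using congrArg i hD)
  apply hst
  apply hi
  replace e0 : i s ^ 2 + i A * i t ^ 2 + i B * i s * i t + i C * i t * i r = 0 := by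
    simpa using congrArg i e0
  replace e1 : i t ^ 2 + i A * i r ^ 2 + i B * i t * i r + i C * i r * i s = 0 := by
    simpa using congrArg i e1
  replace e2 : i r ^ 2 + i A * i s ^ 2 + i B * i r * i s + i C * i s * i t = 0 := by
    simpa using congrArg i e2
  simp only [map_pow]
  generalize i s = s, i t = t, i r = r, i A = A, i B = B, i C = C at *
  -- Rescaling absorbs `θ` into the coefficients `Aθ`, `Bθ²`, so that the coordinates sum to zero.
  obtain ⟨a, rfl⟩ : ∃ a, t = θ ^ 2 * a := ⟨θ * t, by linear_combination -t * hθ⟩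
  obtain ⟨b, rfl⟩ : ∃ b, r = θ * b := ⟨θ ^ 2 * r, by linear_combination -r * hθ⟩
  obtain rfl : s = -(a + b) := by linear_combination hl - (a + b) * hθ
  have f0 : (a + b) ^ 2 + (A * θ) * a ^ 2 - (B * θ ^ 2) * (a + b) * a + C * a * b = 0 := by
    linear_combination e0 - (A * θ * a ^ 2 + C * a * b) * hθ
  have f1 : a ^ 2 + (A * θ) * b ^ 2 + (B * θ ^ 2) * a * b - C * b * (a + b) = 0 := by
    grind
  have f2 : b ^ 2 + (A * θ) * (a + b) ^ 2 - (B * θ ^ 2) * b * (a + b) - C * (a + b) * a = 0 := by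
    grind
  -- Linear system in `Aθ`, `Bθ²`, `C`: its determinant has a circulant factor that vanishes when
  -- the coordinates sum to zero, so the Cramer numerator for `Aθ`, up to sign this cube, vanishes
  -- too.
  have key : (a ^ 2 + a * b + b ^ 2) ^ 3 = 0 := by
    grind
  have key := pow_eq_zero_iff (three_ne_zero) |>.1 key
  grind

/-- The three shifts of the conic `x² + A y² + B xy + C yz`, restricted to the products of the
coordinates with respect to a basis of base points, are linearly independent. -/
theorem circulant_polar_ne_zero {F : Type*} [Field F] {A B C s t r : F}
    (e0 : s ^ 2 + A * t ^ 2 + B * s * t + C * t * r = 0)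
    (e1 : t ^ 2 + A * r ^ 2 + B * t * r + C * r * s = 0)
    (e2 : r ^ 2 + A * s ^ 2 + B * r * s + C * s * t = 0)
    (hD : s ^ 3 + t ^ 3 + r ^ 3 - 3 * s * t * r ≠ 0) (hAB : A * B ≠ C) {α β γ : F}
    (hα : α = 2 * s * t + 2 * A * t * r + B * (s * r + t ^ 2) + C * (t * s + r ^ 2))
    (hβ : β = 2 * t * r + 2 * A * r * s + B * (t * s + r ^ 2) + C * (r * t + s ^ 2))
    (hγ : γ = 2 * s * r + 2 * A * t * s + B * (s ^ 2 + r * t) + C * (t ^ 2 + s * r)) :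
    α ^ 3 + β ^ 3 + γ ^ 3 - 3 * α * β * γ ≠ 0 := by
  intro hN
  obtain ⟨i, hi⟩ : ∃ i : F →+* AlgebraicClosure F, Function.Injective i :=
    ⟨_, (algebraMap F (AlgebraicClosure F)).injective⟩
  obtain ⟨θ, hθ, hl⟩ := exists_cubeRoot_of_circulant_eq_zero
    (a := i α) (b := i β) (c := i γ) (by simpa [map_ofNat i 3] using congrArg i hN)
  apply hAB
  apply hi
  replace hD : i s ^ 3 + i t ^ 3 + i r ^ 3 - 3 * i s * i t * i r ≠ 0 := by
    simpa [map_ofNat i 3] using hi.ne hD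
  replace e0 : i s ^ 2 + i A * i t ^ 2 + i B * i s * i t + i C * i t * i r = 0 := by
    simpa using congrArg i e0
  replace e1 : i t ^ 2 + i A * i r ^ 2 + i B * i t * i r + i C * i r * i s = 0 := by
    simpa using congrArg i e1
  replace e2 : i r ^ 2 + i A * i s ^ 2 + i B * i r * i s + i C * i s * i t = 0 := by
    simpa using congrArg i e2
  subst hα hβ hγ
  simp only [map_add, map_mul, map_pow, map_ofNat] at hl ⊢
  generalize i s = s, i t = t, i r = r, i A = A, i B = B, i C = C at *
  obtain ⟨p, hp⟩ : ∃ p, p = s ^ 2 + θ * t ^ 2 + θ ^ 2 * r ^ 2 := ⟨_, rfl⟩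
  obtain ⟨p', hp'⟩ : ∃ p', p' = s * t + θ * t * r + θ ^ 2 * r * s := ⟨_, rfl⟩
  -- `g1` and `g2` are linear in `1 + θ²A` and `B + θ²C`, with determinant `(θp - p')(θp + 2p')`;
  -- `d1` and `d2` tie both factors to `hD`.
  have g1 : (1 + θ ^ 2 * A) * p + (B + θ ^ 2 * C) * p' = 0 := by
    rw [hp, hp']
    linear_combination e0 + θ * e1 + θ ^ 2 * e2
      + (A * (t ^ 2 + θ * r ^ 2) + C * (t * r + θ * r * s)) * hθ
  have g2 : (1 + θ ^ 2 * A) * (2 * p') + (B + θ ^ 2 * C) * (θ ^ 2 * p + θ * p') = 0 := by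
    rw [hp, hp']
    linear_combination hl + (2 * A * (t * r + θ * r * s) + B * (t ^ 2 + θ * r ^ 2 + r * s)
      + C * (θ * s ^ 2 + θ ^ 2 * t ^ 2 + (θ ^ 3 + 1) * r ^ 2 + s * t + θ * t * r
        + θ ^ 2 * r * s)) * hθ
  have d1 : (θ * p - p') * (s + θ ^ 2 * t + θ * r)
      = θ * (s ^ 3 + t ^ 3 + r ^ 3 - 3 * s * t * r) := by
    rw [hp, hp']
    linear_combination (θ * t ^ 3 + θ * r ^ 3 + s ^ 2 * t + θ ^ 2 * t * r ^ 2
      - θ * s * t * r) * hθ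
  have d2 : θ * p + 2 * p' = θ * (s + θ ^ 2 * t + θ * r) ^ 2 := by
    rw [hp, hp']
    linear_combination -(θ ^ 2 * t ^ 2 + 2 * s * t + 2 * θ * t * r) * hθ
  have hθ0 : θ ≠ 0 := by rintro rfl; simp at hθ
  have hne : (θ * p - p') * (s + θ ^ 2 * t + θ * r) ≠ 0 := d1 ▸ mul_ne_zero hθ0 hD
  have hdet : (θ * p - p') * (θ * p + 2 * p') ≠ 0 :=
    mul_ne_zero (left_ne_zero_of_mul hne)
      (d2 ▸ mul_ne_zero hθ0 (pow_ne_zero 2 (right_ne_zero_of_mul hne)))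
  have k1 : 1 + θ ^ 2 * A = 0 := by
    refine (mul_eq_zero.1 ?_).resolve_right hdet
    linear_combination (θ ^ 2 * p + θ * p') * g1 - p' * g2
  have k2 : B + θ ^ 2 * C = 0 := by
    refine (mul_eq_zero.1 ?_).resolve_right hdet
    linear_combination p * g2 - 2 * p' * g1
  have hA : A = -θ := by linear_combination θ * k1 - A * hθ
  have hB : B = -θ ^ 2 * C := by linear_combination k2
  rw [hA, hB]
  linear_combination C * hθ

/-! ### Base points from roots of the cubic -/

/-- A root of the cubic `m_{A,B,C}` yields a common zero of the conic `x² + A y² + B xy + C yz`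
and its cyclic shifts. -/
theorem basePoint_of_root {F : Type*} [Field F] {A B C ρ r : F} (hC : C ≠ 0) (hAB : A * B ≠ C)
    (h : A ^ 3 - A * B * C + A * B + C ^ 2 - C + 1 = 0)
    (hm : (A * B - C) * ρ ^ 3 + (-(A ^ 2 * C) + A * B ^ 2 - B * C - B) * ρ ^ 2
      + (A ^ 2 * B - A * C ^ 2 - A * C - B ^ 2) * ρ + (-(A * B) + C) = 0)
    (hr : r = -(ρ ^ 2 + B * ρ + A) / C) :
    ρ ^ 2 + A + B * ρ + C * r = 0 ∧ 1 + A * r ^ 2 + B * r + C * r * ρ = 0 ∧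
      r ^ 2 + A * ρ ^ 2 + B * r * ρ + C * ρ = 0 := by
  have hr' : C * r = -(ρ ^ 2 + B * ρ + A) := by rw [hr]; field_simp
  have hd : A * B - C ≠ 0 := sub_ne_zero.2 hAB
  have hc : (A * B - C) ^ 2 * C ^ 2 ≠ 0 := mul_ne_zero (pow_ne_zero 2 hd) (pow_ne_zero 2 hC)
  obtain ⟨g, hg⟩ : ∃ g, g = ρ ^ 2 + B * ρ + A := ⟨_, rfl⟩
  have hrg : C * r = -g := by rw [hg, hr']
  refine ⟨by linear_combination hr', ?_, ?_⟩
  · refine (mul_eq_zero.1 ?_).resolve_left hc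
    have : C ^ 2 * (1 + A * r ^ 2 + B * r + C * r * ρ)
        = C ^ 2 + A * g ^ 2 - B * C * g - C ^ 2 * g * ρ := by
      linear_combination (A * (C * r - g) + B * C + C ^ 2 * ρ) * hrg
    rw [mul_assoc, this, hg]
    linear_combination (ρ * A ^ 2 * B - ρ * A * C + A ^ 3 * C + A ^ 2 * B ^ 2 - A * B * C ^ 2 - A * B * C + A * B + C ^ 3) * hm + (ρ ^ 2 * A ^ 2 * C ^ 2 + ρ ^ 2 * A * B ^ 2 - ρ * A ^ 2 * B * C + ρ * A * B ^ 3 + ρ * A * C ^ 3 + ρ * A * C ^ 2 + A ^ 2 * B ^ 2 - A * B * C) * h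
  · refine (mul_eq_zero.1 ?_).resolve_left hc
    have : C ^ 2 * (r ^ 2 + A * ρ ^ 2 + B * r * ρ + C * ρ)
        = g ^ 2 + A * C ^ 2 * ρ ^ 2 - B * C * g * ρ + C ^ 3 * ρ := by
      linear_combination (C * r - g + B * C * ρ) * hrg
    rw [mul_assoc, this, hg]
    linear_combination (ρ * A * B - ρ * C + A ^ 2 * C - A * B ^ 2 * C + A * B ^ 2 + B * C ^ 2 - B * C + B) * hm + (ρ ^ 2 * A * C ^ 2 + ρ ^ 2 * B ^ 2 - ρ * A * B * C + ρ * B ^ 3 + ρ * C ^ 3 + ρ * C ^ 2 + A * B ^ 2 - B * C) * h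

/-- An irreducible cubic over a finite field whose roots have product `1` has a root in
`μ_{q²+q+1}` over the cubic extension. -/
theorem exists_root_mem_mu {F L : Type*} [Field F] [Finite F] [Field L] [Algebra F L] {q : ℕ}
    (hF : Nat.card F = q) (hL : Nat.card L = q ^ 3) {p : F[X]} (hp : Irreducible p)
    (hdeg : p.natDegree = 3) (hcoeff : p.coeff 0 = -p.leadingCoeff) :
    ∃ u ∈ mu L (q ^ 2 + q + 1), (p.map (algebraMap F L)).IsRoot u := by
  have : Fact (Irreducible p) := ⟨hp⟩
  have hq1 : 1 < q := hF ▸ Finite.one_lt_card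
  have : Finite L := Nat.finite_of_card_ne_zero (by rw [hL]; positivity)
  have hfinL : Module.finrank F L = 3 := by
    have h := Module.natCard_eq_pow_finrank (K := F) (V := L)
    rw [hL, hF] at h
    exact (Nat.pow_right_injective hq1 h).symm
  have hfinK : Module.finrank F (AdjoinRoot p) = 3 := by
    rw [(AdjoinRoot.powerBasis hp.ne_zero).finrank, AdjoinRoot.powerBasis_dim, hdeg]
  have : FiniteDimensional F (AdjoinRoot p) := Module.finite_of_finrank_pos (by omega)
  have : Finite (AdjoinRoot p) := Module.finite_of_finite F
  have hcard : Nat.card (AdjoinRoot p) = q ^ 3 := by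
    rw [Module.natCard_eq_pow_finrank (K := F), hF, hfinK]
  obtain ⟨φ⟩ := FiniteField.nonempty_algHom_of_finrank_dvd (F := F) (K := AdjoinRoot p) (L := L)
    (by rw [hfinK, hfinL])
  -- The norm is the product of the three roots, and it is also the power `q² + q + 1`.
  have hnorm : Algebra.norm F (AdjoinRoot.root p) = 1 := by
    have h := Algebra.PowerBasis.norm_gen_eq_coeff_zero_minpoly (AdjoinRoot.powerBasis hp.ne_zero)
    rw [AdjoinRoot.powerBasis_gen, AdjoinRoot.powerBasis_dim, hdeg,
      AdjoinRoot.minpoly_root hp.ne_zero, coeff_mul_C, hcoeff] at h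
    rw [h, neg_mul, mul_inv_cancel₀ (leadingCoeff_ne_zero.2 hp.ne_zero)]
    norm_num
  have hpow := FiniteField.algebraMap_norm_eq_pow (K := F) (x := AdjoinRoot.root p)
  have hexp : (q ^ 3 - 1) / (q - 1) = q ^ 2 + q + 1 := by
    obtain ⟨k, rfl⟩ := Nat.exists_eq_add_of_lt hq1
    refine Nat.div_eq_of_eq_mul_left (by omega) ?_
    zify [Nat.one_le_pow, show 1 ≤ 1 + k + 1 by omega, Nat.one_le_pow 3 (1 + k + 1) (by omega)]
    ring
  rw [hnorm, map_one, hcard, hF, hexp] at hpow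
  refine ⟨φ (AdjoinRoot.root p), ?_, ?_⟩
  · rw [mu, Set.mem_ofPred_eq, ← map_pow, ← hpow, map_one]
  · rw [IsRoot, eval_map_algebraMap, aeval_algHom_apply, AdjoinRoot.aeval_eq, AdjoinRoot.mk_self,
      map_zero]

theorem eval_mCubic {F : Type*} [Field F] (A B C ρ : F) :
    (mCubic A B C).eval ρ =
      (A * B - C) * ρ ^ 3 + (-(A ^ 2 * C) + A * B ^ 2 - B * C - B) * ρ ^ 2
      + (A ^ 2 * B - A * C ^ 2 - A * C - B ^ 2) * ρ + (-(A * B) + C) := by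
  simp [mCubic]

/-- If `m_{A,B,C}` has no root in `μ_{q²+q+1}`, then it has a root in the ground field which is
not a cube root of unity. -/
theorem exists_root_mCubic {F L : Type*} [Field F] [Finite F] [Field L] [Algebra F L] {q : ℕ}
    (hF : Nat.card F = q) (hL : Nat.card L = q ^ 3) {A B C : F} (hAB : A * B ≠ C)
    (hm : ∀ u ∈ mu L (q ^ 2 + q + 1), ¬ ((mCubic A B C).map (algebraMap F L)).IsRoot u) :
    ∃ ρ : F, (mCubic A B C).eval ρ = 0 ∧ ρ ^ 3 ≠ 1 := by
  have hd : A * B - C ≠ 0 := sub_ne_zero.2 hAB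
  have hdeg : (mCubic A B C).natDegree = 3 := natDegree_cubic hd
  have hroots : (mCubic A B C).roots ≠ 0 := by
    intro h0
    have hirr := (irreducible_iff_roots_eq_zero_of_degree_le_three (by omega) (by omega)).2 h0
    obtain ⟨u, hu, hroot⟩ := exists_root_mem_mu hF hL hirr hdeg (by
      rw [mCubic, leadingCoeff_cubic hd]; simp [neg_add_eq_sub])
    exact hm u hu hroot
  obtain ⟨ρ, hρ⟩ := Multiset.exists_mem_of_ne_zero hroots
  have hρ : (mCubic A B C).eval ρ = 0 := (mem_roots'.1 hρ).2
  refine ⟨ρ, hρ, fun h1 ↦ hm (algebraMap F L ρ) ?_ ?_⟩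
  · have hq : ρ ^ q = ρ := by
      have := Fintype.ofFinite F
      rw [← hF, Nat.card_eq_fintype_card, FiniteField.pow_card]
    rw [mu, Set.mem_ofPred_eq, ← map_pow]
    have : ρ ^ (q ^ 2 + q + 1) = 1 := by
      rw [pow_succ, pow_add, pow_two, pow_mul, hq, hq, ← h1]; ring
    rw [this, map_one]
  · rw [IsRoot, eval_map_algebraMap, aeval_algebraMap_apply, coe_aeval_eq_eval, hρ, map_zero]

/-- If `AB = C`, then `m_{A,B,C}` vanishes identically. -/
theorem mCubic_eq_zero {F : Type*} [Field F] {A B C : F} (hAB : A * B = C)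
    (h : A ^ 3 - A * B * C + A * B + C ^ 2 - C + 1 = 0) : mCubic A B C = 0 := by
  subst hAB
  have hA : A ^ 3 + 1 = 0 := by linear_combination h
  have e1 : -(A ^ 2 * (A * B)) + A * B ^ 2 - B * (A * B) - B = 0 := by linear_combination -B * hA
  have e2 : A ^ 2 * B - A * (A * B) ^ 2 - A * (A * B) - B ^ 2 = 0 := by
    linear_combination -B ^ 2 * hA
  simp [mCubic, e1, e2]

/-! ### Injectivity of the quadratic map up to scalars -/

/-- A circulant combination of the conjugates of `x` determines `x`. -/
theorem circulant_injective {L : Type*} [Field L] {σ : L →+* L} (hσ : ∀ x, σ (σ (σ x)) = x)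
    {a b c : L} (ha : σ a = a) (hb : σ b = b) (hc : σ c = c)
    (h : a ^ 3 + b ^ 3 + c ^ 3 - 3 * a * b * c ≠ 0) :
    Function.Injective fun x ↦ a * x + b * σ x + c * σ (σ x) := by
  intro x y hxy
  obtain ⟨z, rfl⟩ : ∃ z, x = y + z := ⟨x - y, by ring⟩
  simp only [map_add] at hxy
  have e0 : a * z + b * σ z + c * σ (σ z) = 0 := by linear_combination hxy
  have e1 := congrArg σ e0
  have e2 := congrArg σ e1
  simp only [map_add, map_mul, ha, hb, hc, hσ, map_zero] at e1 e2
  have : (a ^ 3 + b ^ 3 + c ^ 3 - 3 * a * b * c) * z = 0 := by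
    linear_combination (a ^ 2 - b * c) * e0 + (c ^ 2 - a * b) * e1 + (b ^ 2 - a * c) * e2
  simp [(mul_eq_zero.1 this).resolve_left h]

/-- Let `σ` be an automorphism of order three. If the conic `x² + A y² + B xy + C yz` and its
cyclic shifts have common zeros `(s, t, r)`, `(t, r, s)`, `(r, s, t)` that are fixed by `σ` and
linearly independent, and the three conics are linearly independent, then the values of the
quadratic map `X ↦ X² + A (σX)² + B XσX + C σXσ²X` at nonzero points are determined up to
fixed scalars by the point up to fixed scalars. -/
theorem quadraticMap_injective {L : Type*} [Field L] [Finite L] {σ : L →+* L}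
    (hσ : ∀ x, σ (σ (σ x)) = x) {A B C s t r α β γ : L}
    (hs : σ s = s) (ht : σ t = t) (hr : σ r = r)
    (hα' : σ α = α) (hβ' : σ β = β) (hγ' : σ γ = γ)
    (e0 : s ^ 2 + A * t ^ 2 + B * s * t + C * t * r = 0)
    (e1 : t ^ 2 + A * r ^ 2 + B * t * r + C * r * s = 0)
    (e2 : r ^ 2 + A * s ^ 2 + B * r * s + C * s * t = 0)
    (hD : s ^ 3 + t ^ 3 + r ^ 3 - 3 * s * t * r ≠ 0)
    (hα : α = 2 * s * t + 2 * A * t * r + B * (s * r + t ^ 2) + C * (t * s + r ^ 2))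
    (hβ : β = 2 * t * r + 2 * A * r * s + B * (t * s + r ^ 2) + C * (r * t + s ^ 2))
    (hγ : γ = 2 * s * r + 2 * A * t * s + B * (s ^ 2 + r * t) + C * (t ^ 2 + s * r))
    (hN : α ^ 3 + β ^ 3 + γ ^ 3 - 3 * α * β * γ ≠ 0)
    {x y k : L} (hx : x ≠ 0) (hk : σ k = k) (hk0 : k ≠ 0)
    (hxy : x ^ 2 + A * σ x ^ 2 + B * x * σ x + C * σ x * σ (σ x)
      = k * (y ^ 2 + A * σ y ^ 2 + B * y * σ y + C * σ y * σ (σ y))) :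
    ∃ c ≠ 0, σ c = c ∧ y = c * x := by
  have inj := circulant_injective hσ hs hr ht (by convert hD using 1; ring)
  have surj := Finite.surjective_of_injective inj
  obtain ⟨u, rfl⟩ := surj x
  obtain ⟨v, rfl⟩ := surj y
  have hu : u ≠ 0 := by rintro rfl; simp at hx
  -- The squares drop out at base points; only the polar terms `α`, `β`, `γ` survive.
  have hQ : ∀ u, (s * u + r * σ u + t * σ (σ u)) ^ 2 + A * σ (s * u + r * σ u + t * σ (σ u)) ^ 2
      + B * (s * u + r * σ u + t * σ (σ u)) * σ (s * u + r * σ u + t * σ (σ u))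
      + C * σ (s * u + r * σ u + t * σ (σ u)) * σ (σ (s * u + r * σ u + t * σ (σ u)))
      = β * (σ u * σ (σ u)) + α * σ (σ u * σ (σ u)) + γ * σ (σ (σ u * σ (σ u))) := by
    intro u
    simp only [map_add, map_mul, hs, ht, hr, hσ]
    rw [hα, hβ, hγ]
    linear_combination u ^ 2 * e0 + σ (σ u) ^ 2 * e1 + σ u ^ 2 * e2
  have inj' := circulant_injective hσ hβ' hα' hγ' (by convert hN using 1; ring)
  have hT : σ u * σ (σ u) = k * (σ v * σ (σ v)) := by
    apply inj'
    simp only [hQ] at hxy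
    simp only [map_mul, hk] at hxy ⊢
    linear_combination hxy
  have hT1 := congrArg σ hT
  simp only [map_mul, hσ, hk] at hT1
  have hσu : σ u ≠ 0 := (map_ne_zero σ).2 hu
  have hσσu : σ (σ u) ≠ 0 := (map_ne_zero σ).2 hσu
  have hσσv : σ (σ v) ≠ 0 := by
    intro h; rw [h, mul_zero, mul_zero] at hT; exact mul_ne_zero hσu hσσu hT
  -- Comparing `hT` with its conjugate shows that `v/u` is fixed by `σ`.
  have hcomm : σ v * u = v * σ u := by
    have : k * σ (σ v) * (σ v * u - v * σ u) = 0 := by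
      linear_combination σ u * hT1 - u * hT
    exact sub_eq_zero.1 ((mul_eq_zero.1 this).resolve_left (mul_ne_zero hk0 hσσv))
  have hc : σ (v / u) = v / u := by
    rw [map_div₀, div_eq_div_iff hσu hu, hcomm]
  have hv : v ≠ 0 := by rintro rfl; simp at hσσv
  refine ⟨v / u, div_ne_zero hv hu, hc, ?_⟩
  have h1 : v = v / u * u := by field_simp
  have h2 := congrArg σ h1
  have h3 := congrArg σ h2
  simp only [map_mul, hc] at h2 h3
  simp only
  rw [h3, h2]
  nth_rewrite 1 [h1]
  ring

/-! ### The permutation property -/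

/-- Clearing denominators in `fQuad` gives a cubic form in the conjugates. -/
theorem eval_fQuad_mul {F L : Type*} [Field F] [Field L] [Algebra F L] {q : ℕ} (hq : 0 < q)
    (A B C : F) (x : L) :
    ((fQuad q A B C).map (algebraMap F L)).eval x * (x * x ^ q) =
      (x ^ q) ^ 2 * (x ^ q) ^ q + algebraMap F L A * x ^ 2 * (x ^ q) ^ q
      + algebraMap F L B * x * x ^ q * (x ^ q) ^ q + algebraMap F L C * x ^ 2 * x ^ q := by
  have hsq : q ≤ q ^ 2 := Nat.le_self_pow two_ne_zero q
  have e1 : x ^ (q ^ 2 + q - 1) * x = x ^ q * (x ^ q) ^ q := by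
    rw [← pow_succ, ← pow_mul, ← pow_add]; congr 1; rw [← pow_two]; omega
  have e2 : x ^ (q ^ 2 - q + 1) * x ^ q = x * (x ^ q) ^ q := by
    rw [← pow_add, ← pow_mul, ← pow_succ']; congr 1; rw [← pow_two]; omega
  have e3 : x ^ q ^ 2 = (x ^ q) ^ q := by rw [← pow_mul, pow_two]
  simp only [fQuad, Polynomial.map_add, Polynomial.map_mul, Polynomial.map_pow, map_X, map_C,
    eval_add, eval_mul, eval_pow, eval_X, eval_C, e3]
  linear_combination x ^ q * e1 + algebraMap F L A * x * e2

theorem theorem3p7 {F L : Type*} [Field F] [Finite F] [Field L] [Algebra F L] (q : ℕ)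
    (hF : Nat.card F = q) (hL : Nat.card L = q ^ 3) (A B C : F)
    (hC : C ≠ 0)
    (h1 : A + B + 1 ≠ 0)
    (h2 : A ^ 3 + A * B + 1 ≠ 0)
    (h3 : A ^ 2 - A * B - A + B ^ 2 - B + 1 ≠ 0)
    (h4 : A ^ 3 - A * B * C + A * B + C ^ 2 - C + 1 = 0)
    (hm : ∀ u ∈ mu L (q ^ 2 + q + 1), ¬ ((mCubic A B C).map (algebraMap F L)).IsRoot u) :
    IsPermutationPolynomial ((fQuad q A B C).map (algebraMap F L)) := by
  have hq0 : 0 < q := hF ▸ Nat.card_pos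
  have : Finite L := Nat.finite_of_card_ne_zero (by rw [hL]; positivity)
  have hAB : A * B ≠ C := by
    intro h
    refine hm 1 (one_pow _) ?_
    rw [mCubic_eq_zero h h4]
    simp
  obtain ⟨ρ, hρ, hρ3⟩ := exists_root_mCubic hF hL hAB hm
  rw [eval_mCubic] at hρ
  obtain ⟨r, hr⟩ : ∃ r, r = -(ρ ^ 2 + B * ρ + A) / C := ⟨_, rfl⟩
  obtain ⟨b0, b1, b2⟩ := basePoint_of_root hC hAB h4 hρ hr
  have e0 : ρ ^ 2 + A * 1 ^ 2 + B * ρ * 1 + C * 1 * r = 0 := by linear_combination b0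
  have e1 : 1 ^ 2 + A * r ^ 2 + B * 1 * r + C * r * ρ = 0 := by linear_combination b1
  have e2 : r ^ 2 + A * ρ ^ 2 + B * r * ρ + C * ρ * 1 = 0 := by linear_combination b2
  have hD := circulant_ne_zero_of_basePoint e0 e1 e2 (by simpa using hρ3)
  obtain ⟨α, hα⟩ : ∃ α, α = 2 * ρ * 1 + 2 * A * 1 * r + B * (ρ * r + 1 ^ 2)
    + C * (1 * ρ + r ^ 2) := ⟨_, rfl⟩
  obtain ⟨β, hβ⟩ : ∃ β, β = 2 * 1 * r + 2 * A * r * ρ + B * (1 * ρ + r ^ 2)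
    + C * (r * 1 + ρ ^ 2) := ⟨_, rfl⟩
  obtain ⟨γ, hγ⟩ : ∃ γ, γ = 2 * ρ * r + 2 * A * 1 * ρ + B * (ρ ^ 2 + r * 1)
    + C * (1 ^ 2 + ρ * r) := ⟨_, rfl⟩
  have hN := circulant_polar_ne_zero e0 e1 e2 hD hAB hα hβ hγ
  obtain ⟨σ, hσF, hσq⟩ : ∃ σ : L →+* L, (∀ a : F, σ (algebraMap F L a) = algebraMap F L a) ∧
      ∀ x, σ x = x ^ q := by
    have := Fintype.ofFinite F
    exact ⟨FiniteField.frobeniusAlgHom F L, (FiniteField.frobeniusAlgHom F L).commutes, fun x ↦ by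
      simp [← hF, Nat.card_eq_fintype_card]⟩
  have hσ : ∀ x, σ (σ (σ x)) = x := by
    intro x
    have := Fintype.ofFinite L
    rw [hσq, hσq, hσq, ← pow_mul, ← pow_mul, show q * (q * q) = q ^ 3 by ring, ← hL,
      Nat.card_eq_fintype_card, FiniteField.pow_card]
  have hinj := (algebraMap F L).injective
  have quad := fun {x y k : L} ↦ quadraticMap_injective (x := x) (y := y) (k := k) hσ
    (A := algebraMap F L A) (B := algebraMap F L B) (C := algebraMap F L C)
    (hσF ρ) (hσF 1) (hσF r) (hσF α) (hσF β) (hσF γ)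
    (by simpa using congrArg (algebraMap F L) e0) (by simpa using congrArg (algebraMap F L) e1)
    (by simpa using congrArg (algebraMap F L) e2)
    (by simpa only [map_add, map_sub, map_mul, map_pow, map_ofNat, map_zero] using hinj.ne hD)
    (by simp only [hα, map_add, map_mul, map_pow, map_ofNat])
    (by simp only [hβ, map_add, map_mul, map_pow, map_ofNat])
    (by simp only [hγ, map_add, map_mul, map_pow, map_ofNat])
    (by simpa only [map_add, map_sub, map_mul, map_pow, map_ofNat, map_zero] using hinj.ne hN)
  generalize hf : (fQuad q A B C).map (algebraMap F L) = f
  have hval : ∀ x, f.eval x * (x * σ x) =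
      σ x ^ 2 * σ (σ x) + algebraMap F L A * x ^ 2 * σ (σ x)
      + algebraMap F L B * x * σ x * σ (σ x) + algebraMap F L C * x ^ 2 * σ x := by
    intro x
    rw [← hf, hσq, hσq, eval_fQuad_mul hq0 A B C x]
  have hσ0 : ∀ x ≠ 0, σ x ≠ 0 := fun x hx ↦ (map_ne_zero σ).2 hx
  have hquad : ∀ x ≠ 0, x⁻¹ ^ 2 + algebraMap F L A * σ x⁻¹ ^ 2
      + algebraMap F L B * x⁻¹ * σ x⁻¹ + algebraMap F L C * σ x⁻¹ * σ (σ x⁻¹)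
      = f.eval x / (x * σ x * σ (σ x)) := by
    intro x hx
    have h1 := hσ0 x hx
    have h2 := hσ0 _ h1
    rw [eq_div_iff (by positivity)]
    refine mul_right_cancel₀ (mul_ne_zero hx h1) ?_
    rw [hval x]
    simp only [map_inv₀]
    field_simp
  have hf0 : f.eval 0 = 0 := by
    have h1 : q ^ 2 + q - 1 ≠ 0 := by have := pow_pos hq0 2; omega
    simp [← hf, fQuad, h1, hq0.ne']
  have hfne : ∀ x ≠ 0, f.eval x ≠ 0 := by
    intro x hx h
    -- A zero of `f` would give `Q(1/x) = Q(0)`, making `0` a nonzero multiple of `1/x`.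
    obtain ⟨c, hc, -, h0⟩ := quad (x := x⁻¹) (y := 0) (k := 1) (inv_ne_zero hx) (map_one σ)
      one_ne_zero (by rw [hquad x hx, h]; simp)
    exact mul_ne_zero hc (inv_ne_zero hx) h0.symm
  refine Finite.injective_iff_bijective.1 fun x y (hxy : f.eval x = f.eval y) ↦ ?_
  by_cases hx : x = 0
  · subst hx
    by_contra hy
    exact hfne y (Ne.symm hy) (by rw [← hxy, hf0])
  by_cases hy : y = 0
  · subst hy
    exact absurd (by rw [hxy, hf0]) (hfne x hx)
  have hx1 := hσ0 x hx
  have hx2 := hσ0 _ hx1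
  have hy1 := hσ0 y hy
  have hy2 := hσ0 _ hy1
  -- Here `k` is the ratio of the norms of `y` and `x`.
  obtain ⟨c, hc, hσc, h⟩ := quad (x := x⁻¹) (y := y⁻¹)
    (k := (y * σ y * σ (σ y)) / (x * σ x * σ (σ x))) (inv_ne_zero hx)
    (by simp only [map_div₀, map_mul, hσ]; congr 1 <;> ring)
    (by simp [*]) (by rw [hquad x hx, hquad y hy, hxy]; field_simp)
  obtain rfl : x = c * y := by field_simp at h; rw [h, mul_comm]
  have hvx := hval (c * y)
  simp only [map_mul, hσc] at hvx
  have key : (c - 1) * (c ^ 2 * (f.eval y * (y * σ y))) = 0 := by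
    rw [hxy] at hvx
    linear_combination c ^ 3 * hval y - hvx
  have hc1 := (mul_eq_zero.1 key).resolve_right (mul_ne_zero (pow_ne_zero 2 hc)
    (mul_ne_zero (hfne y hy) (mul_ne_zero hy hy1)))
  rw [sub_eq_zero.1 hc1, one_mul]
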